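/- Let $\mathsf{ZFA}$ be the first-order theory, in the language $\{\in\}$, obtained from $\mathsf{ZFC}$ by replacing the Axiom of Foundation with the Anti-Foundation Axiom: every flat system of equations has a unique solution. Here a flat system is given by disjoint sets $X$ (the indeterminates) and $A$ and a function $x \mapsto S_x$ on $X$ with $S_x \subseteq X \cup A$, and a solution is a function $f$ on $X$ with $f(x) = \{f(y) : y \in S_x \cap X\} \cup (S_x \cap A)$ for all $x \in X$. For an $\{\in\}$-structure $M$, let $S(x,y)$ be the relation $x \in y \lor y \in x$ and $D(x,y)$ the relation $x \in y \land y \in x$. The SD-graph $M_0$ of $M$ is its reduct to $\{S, D\}$ and the D-graph $M_1$ of $M$ is its reduct to $\{D\}$. Let $M \models \mathsf{ZFA}$. Then: 1. there is a countable structure $N \equiv M_0$ which is not isomorphic to the SD-graph of any model of $\mathsf{ZFA}$; 2. there is a countable structure $N' \equiv M_1$ which is not isomorphic to the D-graph of any model of $\mathsf{ZFA}$; 3. the D-graph $M_1$ has a connected component of infinite diameter (the distances between pairs of points of that component are unbounded). -/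

import Mathlib

open scoped FirstOrder

universe u v

namespace AntiFoundation

open FirstOrder FirstOrder.Language

/-! ### The languages `{∈}`, `{S, D}` and `{D}` -/

/-- The relation symbols of the language of set theory: a binary symbol for membership. -/
inductive MemRel : ℕ → Type
  | mem : MemRel 2

/-- The language of set theory, with one binary relation symbol. -/
def LSet : FirstOrder.Language.{0, 0} := ⟨fun _ => Empty, MemRel⟩

/-- The symbol `∈`. -/
abbrev memSym : LSet.Relations 2 := MemRel.mem

/-- The relation symbols of the language with two binary symbols `S` and `D`. -/
inductive SDRel : ℕ → Type
  | S : SDRel 2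
  | D : SDRel 2

/-- The language with two binary relation symbols `S` and `D`. -/
def LSD : FirstOrder.Language.{0, 0} := ⟨fun _ => Empty, SDRel⟩

/-- The relation symbols of the language with one binary symbol `D`. -/
inductive DRel : ℕ → Type
  | D : DRel 2

/-- The language with one binary relation symbol `D`. -/
def LD : FirstOrder.Language.{0, 0} := ⟨fun _ => Empty, DRel⟩

/-- The symbol `D` of the language `{D}`. -/
abbrev dSym : LD.Relations 2 := DRel.D

/-! ### Formulas of set theory

Formulas are written with de Bruijn levels: under `n` quantifiers the variables are the elements
of `Fin n`, a further quantifier binds the variable `Fin.last n`, and the old variables `x` are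
then called `↟x`. -/

/-- Formulas of set theory in the variables `Fin n`. -/
abbrev Fm (n : ℕ) : Type := LSet.BoundedFormula Empty n

local prefix:max "↟" => Fin.castSucc

variable {n : ℕ}

/-- `x ∈ y` -/
def mem (x y : Fin n) : Fm n :=
  memSym.boundedFormula₂ (&x) (&y)

/-- `x = y` -/
def eq (x y : Fin n) : Fm n := (&x) =' (&y)

/-- `x ⊆ y` -/
def subset (x y : Fin n) : Fm n :=
  ∀' (mem (.last _) ↟x ⟹ mem (.last _) ↟y)

/-- `x = ∅` -/
def isEmpty (x : Fin n) : Fm n :=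
  ∀' ∼(mem (.last _) ↟x)

/-- `z = {x, y}` -/
def isPair (z x y : Fin n) : Fm n :=
  ∀' (mem (.last _) ↟z ⇔ (eq (.last _) ↟x ⊔ eq (.last _) ↟y))

/-- `z = x ∪ {x}` -/
def isSucc (z x : Fin n) : Fm n :=
  ∀' (mem (.last _) ↟z ⇔ (mem (.last _) ↟x ⊔ eq (.last _) ↟x))

/-- `z` is the Kuratowski pair `(x, y) = {{x}, {x, y}}`. -/
def isOrderedPair (z x y : Fin n) : Fm n :=
  ∃' ∃' (isPair ↟(.last _) ↟↟x ↟↟x ⊓ isPair (.last _) ↟↟x ↟↟y ⊓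
    isPair ↟↟z ↟(.last _) (.last _))

/-- `(x, y) ∈ f` -/
def pairMem (f x y : Fin n) : Fm n :=
  ∃' (isOrderedPair (.last _) ↟x ↟y ⊓ mem (.last _) ↟f)

/-- `f` is a function with domain `X`. -/
def isFunction (f X : Fin n) : Fm n :=
  (∀' (mem (.last _) ↟f ⟹
    ∃' ∃' (mem ↟(.last _) ↟↟↟X ⊓ isOrderedPair ↟↟(.last _) ↟(.last _) (.last _)))) ⊓
  (∀' (mem (.last _) ↟X ⟹
    ∃' ∀' (pairMem ↟↟↟f ↟↟(.last _) (.last _) ⇔ eq (.last _) ↟(.last _))))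

/-- `X` and `A` are disjoint, and `e` is a flat system of equations with set of indeterminates `X`
and set of constants `A`: it is a function on `X` which assigns to each `x` in `X` the right-hand
side `e(x) ⊆ X ∪ A` of the equation `x = e(x)`. -/
def isFlatSystem (X A e : Fin n) : Fm n :=
  (∀' ∼(mem (.last _) ↟X ⊓ mem (.last _) ↟A)) ⊓ isFunction e X ⊓
  -- for all `x ∈ X` and `s = e(x)`, every `y ∈ s` belongs to `X` or to `A`
  (∀' ∀' (mem ↟(.last _) ↟↟X ⊓ pairMem ↟↟e ↟(.last _) (.last _) ⟹
    ∀' (mem (.last _) ↟(.last _) ⟹ (mem (.last _) ↟↟↟X ⊔ mem (.last _) ↟↟↟A))))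

/-- `f` is a solution of the flat system `e`: it is a function on `X`, and
`f(x) = {f(y) | y ∈ e(x) ∩ X} ∪ (e(x) ∩ A)` for every `x` in `X`. -/
def isSolution (X A e f : Fin n) : Fm n :=
  isFunction f X ⊓
  -- for all `x ∈ X`, `s = e(x)`, `t = f(x)` and all `w`
  (∀' ∀' ∀' (mem ↟↟(.last _) ↟↟↟X ⊓ pairMem ↟↟↟e ↟↟(.last _) ↟(.last _) ⊓
      pairMem ↟↟↟f ↟↟(.last _) (.last _) ⟹
    ∀' (mem (.last _) ↟(.last _) ⇔
      ((∃' (mem (.last _) ↟↟↟(.last _) ⊓ mem (.last _) ↟↟↟↟↟X ⊓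
          pairMem ↟↟↟↟↟f (.last _) ↟(.last _))) ⊔
        (mem (.last _) ↟↟(.last _) ⊓ mem (.last _) ↟↟↟↟A)))))

/-! ### The axioms

In the sentences below the variable bound by the `k`-th nested quantifier, counting from zero,
is the numeral `k`. -/

/-- Sets with the same elements are equal. -/
def extensionality : LSet.Sentence :=
  ∀' ∀' ((∀' (mem (n := 3) 2 0 ⇔ mem 2 1)) ⟹ eq (n := 2) 0 1)

/-- For all `x` and `y` the set `{x, y}` exists. -/
def pairing : LSet.Sentence :=
  ∀' ∀' ∃' (isPair (n := 3) 2 0 1)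

/-- For every `x` the set `⋃ x` exists. -/
def union : LSet.Sentence :=
  ∀' ∃' ∀' (mem (n := 3) 2 1 ⇔ ∃' (mem (n := 4) 2 3 ⊓ mem 3 0))

/-- For every `x` the set of all subsets of `x` exists. -/
def powerSet : LSet.Sentence :=
  ∀' ∃' ∀' (mem (n := 3) 2 1 ⇔ subset 2 0)

/-- There is a set which contains `∅` and is closed under `x ↦ x ∪ {x}`. -/
def infinity : LSet.Sentence :=
  ∃' ((∃' (isEmpty (n := 2) 1 ⊓ mem 1 0)) ⊓
    ∀' (mem (n := 2) 1 0 ⟹ ∃' (isSucc (n := 3) 2 1 ⊓ mem 2 0)))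

/-- Every set of non-empty pairwise disjoint sets has a transversal. -/
def choice : LSet.Sentence :=
  ∀' ((∀' (mem (n := 2) 1 0 ⟹ ∼(isEmpty (n := 2) 1))) ⊓
      (∀' ∀' (mem (n := 3) 1 0 ⊓ mem 2 0 ⊓ (∃' (mem (n := 4) 3 1 ⊓ mem 3 2)) ⟹ eq 1 2)) ⟹
    ∃' ∀' (mem (n := 3) 2 0 ⟹ ∃' ∀' ((mem (n := 5) 4 1 ⊓ mem 4 2) ⇔ eq 4 3)))

/-- The instance of Separation for the formula `φ(p, x)` with parameters `p`:
for all `p` and `a` the set `{x ∈ a | φ(p, x)}` exists. -/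
def separation {k : ℕ} (φ : LSet.Formula (Fin k ⊕ Unit)) : LSet.Sentence :=
  BoundedFormula.alls (n := k) <|
    -- the variables are `p, a, b, x`
    ∀' ∃' ∀' (mem (.last _) ↟(.last _) ⇔
      (mem (.last _) ↟↟(.last _) ⊓
        (BoundedFormula.relabel
          (Sum.elim (fun i => Sum.inr ↟↟↟i) (fun _ => Sum.inr (.last _))) φ : Fm (k + 3))))

/-- The instance of Replacement for the formula `φ(p, x, y)` with parameters `p`, where `x` is
the variable `0` and `y` is the variable `1` of `Fin 2`: for all `p` and `a`, if for each `x ∈ a`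
there is at most one `y` with `φ(p, x, y)`, then the set `{y | ∃ x ∈ a, φ(p, x, y)}` exists. -/
def replacement {k : ℕ} (φ : LSet.Formula (Fin k ⊕ Fin 2)) : LSet.Sentence :=
  BoundedFormula.alls (n := k) <|
    ∀' (
      -- the variables are `p, a, x, y, y'`
      (∀' ∀' ∀' (mem ↟↟(.last _) ↟↟↟(.last _) ⊓
          (BoundedFormula.relabel (Sum.elim (fun i => Sum.inr ↟↟↟↟i)
            ![Sum.inr ↟↟(.last _), Sum.inr ↟(.last _)]) φ : Fm (k + 4)) ⊓
          (BoundedFormula.relabel (Sum.elim (fun i => Sum.inr ↟↟↟↟i)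
            ![Sum.inr ↟↟(.last _), Sum.inr (.last _)]) φ : Fm (k + 4)) ⟹
        eq ↟(.last _) (.last _))) ⟹
      -- the variables are `p, a, b, y, x`
      ∃' ∀' (mem (.last _) ↟(.last _) ⇔
        ∃' (mem (.last _) ↟↟↟(.last _) ⊓
          (BoundedFormula.relabel (Sum.elim (fun i => Sum.inr ↟↟↟↟i)
            ![Sum.inr (.last _), Sum.inr ↟(.last _)]) φ : Fm (k + 4)))))

/-- The Anti-Foundation Axiom: every flat system of equations has a unique solution. -/
def antiFoundation : LSet.Sentence :=
  -- the variables are `X, A, e, f, g`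
  ∀' ∀' ∀' (isFlatSystem (n := 3) 0 1 2 ⟹
    ∃' (isSolution (n := 4) 0 1 2 3 ⊓ ∀' (isSolution (n := 5) 0 1 2 4 ⟹ eq 4 3)))

/-- The axioms of `ZFA`: those of `ZFC` with Foundation replaced by Anti-Foundation. -/
inductive IsAxiom : LSet.Sentence → Prop
  | extensionality : IsAxiom extensionality
  | pairing : IsAxiom pairing
  | union : IsAxiom union
  | powerSet : IsAxiom powerSet
  | infinity : IsAxiom infinity
  | choice : IsAxiom choice
  | separation {k : ℕ} (φ : LSet.Formula (Fin k ⊕ Unit)) : IsAxiom (separation φ)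
  | replacement {k : ℕ} (φ : LSet.Formula (Fin k ⊕ Fin 2)) : IsAxiom (replacement φ)
  | antiFoundation : IsAxiom antiFoundation

/-- The theory `ZFA`, as a set of first-order sentences. -/
def ZFA : LSet.Theory := {φ | IsAxiom φ}

/-! ### Single-double-membership graphs and double-membership graphs -/

/-- `Mem x y` says that `x ∈ y` holds in the structure `M`. -/
def Mem {M : Type u} [LSet.Structure M] (x y : M) : Prop :=
  Structure.RelMap memSym ![x, y]

/-- The domain of the SD-graph of `M`, a copy of `M`. -/
def SDGraph (M : Type u) : Type u := M

/-- The SD-graph of `M`: `S x y` is `x ∈ y ∨ y ∈ x`, and `D x y` is `x ∈ y ∧ y ∈ x`. -/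
instance (M : Type u) [LSet.Structure M] : LSD.Structure (SDGraph M) where
  funMap f := Empty.elim f
  RelMap {_} r := match r with
    | SDRel.S => fun x : Fin 2 → M => Mem (x 0) (x 1) ∨ Mem (x 1) (x 0)
    | SDRel.D => fun x : Fin 2 → M => Mem (x 0) (x 1) ∧ Mem (x 1) (x 0)

/-- The domain of the D-graph of `M`, a copy of `M`. -/
def DGraph (M : Type u) : Type u := M

/-- The D-graph of `M`: `D x y` is `x ∈ y ∧ y ∈ x`. -/
instance (M : Type u) [LSet.Structure M] : LD.Structure (DGraph M) where
  funMap f := Empty.elim f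
  RelMap {_} r := match r with
    | DRel.D => fun x : Fin 2 → M => Mem (x 0) (x 1) ∧ Mem (x 1) (x 0)

/-- The simple graph underlying an `LD`-structure, obtained by forgetting loops (and directions,
if `D` is not symmetric). If `D` is symmetric, it has the same distances and components. -/
def toSimpleGraph (A : Type u) [LD.Structure A] : SimpleGraph A :=
  SimpleGraph.fromRel fun x y => Structure.RelMap dSym ![x, y]

/-- Some connected component of the `LD`-structure `A` has infinite diameter: the distances
between two of its points are not bounded by any natural number. -/
def HasComponentOfInfiniteDiameter (A : Type u) [LD.Structure A] : Prop :=
  ∃ C : (toSimpleGraph A).ConnectedComponent, C.toSimpleGraph.ediam = ⊤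

end AntiFoundation

namespace AntiFoundation

open FirstOrder FirstOrder.Language

/-! ### Semantics of the set-theoretic formulas. -/

section Semantics

variable {M : Type u} [LSet.Structure M] {n : ℕ} {e : Empty → M} {v : Fin n → M}

/-! Call a point bounded if some finite number of `D`-steps suffices to reach everything in its
component. Every model of ZFA has an unbounded point, which is already the third claim. Yet the
bounded points of the SD-graph form an elementary substructure, and boundedness with a fixed radius
is first-order. So a countable structure elementarily embedded in that substructure has only bounded
points; neither it nor its reduct to `D` is the graph of a model.

Both halves rest on `exists_copy`: Anti-Foundation realises any definable digraph on a set by new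
sets, with freely prescribed elements in a given set `T` and no `D`-neighbours outside the copy.
Copying the successor graph of an inductive set gives an unbounded point (`exists_not_bounded`).
Elementarity is a locality argument in the style of Gaifman, with back-and-forth along `IsLocalIso`.
A point near the old ones is matched by the given isomorphism; a distant one is matched by a copy of
its ball, which is a bounded component (`IsLocalIso.exists_snoc_of_not_reach`). The isomorphisms
must stay definable, because they enter the next system of equations inside the model. -/

theorem realize_mem {x y : Fin n} : (mem x y).Realize e v ↔ Mem (v x) (v y) := by
  simp [mem, Mem, BoundedFormula.realize_rel₂]

theorem realize_eq {x y : Fin n} : (eq x y).Realize e v ↔ v x = v y := by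
  simp [eq]

theorem realize_subset {x y : Fin n} :
    (subset x y).Realize e v ↔ ∀ z, Mem z (v x) → Mem z (v y) := by
  simp [subset, realize_mem]

theorem realize_isEmpty {x : Fin n} : (isEmpty x).Realize e v ↔ ∀ z, ¬Mem z (v x) := by
  simp [isEmpty, realize_mem]

/-- `z = {x, y}` in `M`. -/
def IsPair (z x y : M) : Prop := ∀ w, Mem w z ↔ w = x ∨ w = y

/-- `z = x ∪ {x}` in `M`. -/
def IsSucc (z x : M) : Prop := ∀ w, Mem w z ↔ Mem w x ∨ w = x

/-- `z` is the Kuratowski pair of `x` and `y` in `M`. -/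
def IsOrderedPair (z x y : M) : Prop := ∃ s t, IsPair s x x ∧ IsPair t x y ∧ IsPair z s t

/-- `f` contains the Kuratowski pair of `x` and `y`. -/
def PairMem (f x y : M) : Prop := ∃ p, IsOrderedPair p x y ∧ Mem p f

/-- `f` is a function with domain `X` in `M`. -/
def IsFunction (f X : M) : Prop :=
  (∀ p, Mem p f → ∃ x y, Mem x X ∧ IsOrderedPair p x y) ∧
  ∀ x, Mem x X → ∃ y, ∀ z, PairMem f x z ↔ z = y

theorem realize_isPair {z x y : Fin n} :
    (isPair z x y).Realize e v ↔ IsPair (v z) (v x) (v y) := by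
  simp [isPair, IsPair, realize_mem, realize_eq]

theorem realize_isSucc {z x : Fin n} :
    (isSucc z x).Realize e v ↔ IsSucc (v z) (v x) := by
  simp [isSucc, IsSucc, realize_mem, realize_eq]

theorem realize_isOrderedPair {z x y : Fin n} :
    (isOrderedPair z x y).Realize e v ↔ IsOrderedPair (v z) (v x) (v y) := by
  simp [isOrderedPair, IsOrderedPair, realize_isPair, and_assoc]

theorem realize_pairMem {f x y : Fin n} :
    (pairMem f x y).Realize e v ↔ PairMem (v f) (v x) (v y) := by
  simp [pairMem, PairMem, realize_isOrderedPair, realize_mem]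

theorem realize_isFunction {f X : Fin n} :
    (isFunction f X).Realize e v ↔ IsFunction (v f) (v X) := by
  simp [isFunction, IsFunction, realize_isOrderedPair, realize_mem, realize_pairMem, realize_eq]

theorem realize_isFlatSystem {X A s : Fin n} :
    (isFlatSystem X A s).Realize e v ↔
      (∀ y, ¬(Mem y (v X) ∧ Mem y (v A))) ∧ IsFunction (v s) (v X) ∧
      ∀ x t, Mem x (v X) → PairMem (v s) x t →
        ∀ y, Mem y t → Mem y (v X) ∨ Mem y (v A) := by
  simp [isFlatSystem, realize_isFunction, realize_mem, realize_pairMem, and_assoc]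

theorem realize_isSolution {X A s f : Fin n} :
    (isSolution X A s f).Realize e v ↔
      IsFunction (v f) (v X) ∧
      ∀ x t y, Mem x (v X) → PairMem (v s) x t → PairMem (v f) x y → ∀ z, Mem z y ↔
        (∃ x', Mem x' t ∧ Mem x' (v X) ∧ PairMem (v f) x' z) ∨ (Mem z t ∧ Mem z (v A)) := by
  simp [isSolution, realize_isFunction, realize_mem, realize_pairMem, and_assoc]

end Semantics

/-! ### Definability with parameters, inferred by instance search. -/

section Definability

variable {M : Type u} [LSet.Structure M] {n : ℕ}

/-- A function of `n` arguments which is a variable or a constant. -/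
class IsTerm (t : (Fin n → M) → M) : Prop where
  exists_term : ∃ τ : LSet.Term (M ⊕ Fin n), ∀ v, τ.realize (Sum.elim id v) = t v

/-- A predicate of `n` arguments which is definable with parameters. -/
class IsDefinable (P : (Fin n → M) → Prop) : Prop where
  exists_formula : ∃ φ : LSet.BoundedFormula M n, ∀ v, φ.Realize id v ↔ P v

/-- A binary relation which is definable with parameters. -/
class IsDefinable₂ (R : M → M → Prop) : Prop where
  comp : ∀ {n : ℕ} (s t : (Fin n → M) → M) [IsTerm s] [IsTerm t],
    IsDefinable fun v => R (s v) (t v)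

instance IsTerm.var (i : Fin n) : IsTerm fun v : Fin n → M => v i :=
  ⟨Term.var (Sum.inr i), fun _ => rfl⟩

instance IsTerm.const (c : M) : IsTerm fun _ : Fin n → M => c :=
  ⟨Term.var (Sum.inl c), fun _ => rfl⟩

/-- Below a quantifier the old variables are reindexed by `Fin.castSucc`; this lets instance search
carry terms under binders. -/
instance IsTerm.comp {m : ℕ} (t : (Fin n → M) → M) (σ : Fin n → Fin m) [h : IsTerm t] :
    IsTerm fun v : Fin m → M => t fun i => v (σ i) := by
  obtain ⟨τ, hτ⟩ := h
  refine ⟨τ.relabel (Sum.map id σ), fun v => ?_⟩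
  rw [Term.realize_relabel, ← hτ]
  congr 1
  ext i
  cases i <;> rfl

namespace IsDefinable

variable (P Q : (Fin n → M) → Prop) (s t : (Fin n → M) → M)

instance mem [hs : IsTerm s] [ht : IsTerm t] : IsDefinable fun v => Mem (s v) (t v) := by
  obtain ⟨σ, hσ⟩ := hs
  obtain ⟨τ, hτ⟩ := ht
  exact ⟨memSym.boundedFormula₂ σ τ, fun v => by simp [BoundedFormula.realize_rel₂, hσ, hτ, Mem]⟩

instance eq [hs : IsTerm s] [ht : IsTerm t] : IsDefinable fun v => s v = t v := by
  obtain ⟨σ, hσ⟩ := hs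
  obtain ⟨τ, hτ⟩ := ht
  exact ⟨σ =' τ, fun v => by simp [hσ, hτ]⟩

instance comp₂ (R : M → M → Prop) [h : IsDefinable₂ R] [IsTerm s] [IsTerm t] :
    IsDefinable fun v => R (s v) (t v) := h.comp s t

instance false : IsDefinable fun _ : Fin n → M => False := ⟨⊥, fun _ => by simp⟩

instance not [hP : IsDefinable P] : IsDefinable fun v => ¬P v := by
  obtain ⟨φ, hφ⟩ := hP
  exact ⟨∼φ, fun v => by simp [hφ]⟩

instance and [hP : IsDefinable P] [hQ : IsDefinable Q] : IsDefinable fun v => P v ∧ Q v := by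
  obtain ⟨φ, hφ⟩ := hP
  obtain ⟨ψ, hψ⟩ := hQ
  exact ⟨φ ⊓ ψ, fun v => by simp [hφ, hψ]⟩

instance or [hP : IsDefinable P] [hQ : IsDefinable Q] : IsDefinable fun v => P v ∨ Q v := by
  obtain ⟨φ, hφ⟩ := hP
  obtain ⟨ψ, hψ⟩ := hQ
  exact ⟨φ ⊔ ψ, fun v => by simp [hφ, hψ]⟩

instance iff [hP : IsDefinable P] [hQ : IsDefinable Q] : IsDefinable fun v => P v ↔ Q v := by
  obtain ⟨φ, hφ⟩ := hP
  obtain ⟨ψ, hψ⟩ := hQ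
  exact ⟨φ ⇔ ψ, fun v => by simp [hφ, hψ]⟩

instance all (R : (Fin n → M) → M → Prop)
    [h : IsDefinable fun w : Fin (n + 1) → M => R (fun i => w i.castSucc) (w (Fin.last n))] :
    IsDefinable fun v => ∀ x, R v x := by
  obtain ⟨φ, hφ⟩ := h
  exact ⟨∀' φ, fun v => by simp [hφ]⟩

instance ex (R : (Fin n → M) → M → Prop)
    [h : IsDefinable fun w : Fin (n + 1) → M => R (fun i => w i.castSucc) (w (Fin.last n))] :
    IsDefinable fun v => ∃ x, R v x := by
  obtain ⟨φ, hφ⟩ := h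
  exact ⟨∃' φ, fun v => by simp [hφ]⟩

/-- A disjunction over an external finite index, not a quantifier over `M`; needed for balls about
tuples. -/
theorem finite_ex {ι : Type*} [Finite ι] (R : ι → (Fin n → M) → Prop)
    (h : ∀ i, IsDefinable (R i)) : IsDefinable fun v => ∃ i, R i v := by
  choose φ hφ using fun i => (h i).exists_formula
  exact ⟨BoundedFormula.iSup φ, fun v => by simp [hφ]⟩

variable (r : (Fin n → M) → M) [IsTerm r] [IsTerm s] [IsTerm t]

instance isPair : IsDefinable fun v => IsPair (r v) (s v) (t v) := by
  unfold IsPair; infer_instance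

instance isSucc : IsDefinable fun v => IsSucc (r v) (s v) := by
  unfold IsSucc; infer_instance

instance isOrderedPair : IsDefinable fun v => IsOrderedPair (r v) (s v) (t v) := by
  unfold IsOrderedPair; infer_instance

instance pairMem : IsDefinable fun v => PairMem (r v) (s v) (t v) := by
  unfold PairMem; infer_instance

end IsDefinable

end Definability

/-! ### Set theory inside a model, and solutions of definable systems. -/

section SetTheory

variable {M : Type u} [LSet.Structure M]

/-- A formula mentions only finitely many parameters, and the Separation schema accepts only finite
tuples of them. -/
theorem exists_formula_finite {P : M → Prop}
    (h : IsDefinable fun v : Fin 1 → M => P (v 0)) :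
    ∃ (k : ℕ) (p : Fin k → M) (φ : LSet.Formula (Fin k ⊕ Unit)),
      ∀ x, φ.Realize (Sum.elim p fun _ => x) ↔ P x := by
  classical
  obtain ⟨φ, hφ⟩ := h
  let c := φ.freeVarFinset.equivFin
  refine ⟨_, fun i => (c.symm i).1,
    (φ.restrictFreeVar c).toFormula.relabel (Sum.map id fun _ => ()), fun x => ?_⟩
  rw [Formula.realize_relabel, BoundedFormula.realize_toFormula,
    BoundedFormula.realize_restrictFreeVar id (by simp)]
  exact hφ fun _ => x

theorem isPair_right_injective {z v x y : M} (hx : IsPair z v x) (hy : IsPair z v y) : x = y := by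
  have h1 := (hy x).1 ((hx x).2 (.inr rfl))
  have h2 := (hx y).1 ((hy y).2 (.inr rfl))
  grind

theorem IsOrderedPair.injective {z x y x' y' : M} (h : IsOrderedPair z x y)
    (h' : IsOrderedPair z x' y') : x = x' ∧ y = y' := by
  obtain ⟨s, t, hs, ht, hz⟩ := h
  obtain ⟨s', t', hs', ht', hz'⟩ := h'
  have key : x = x' := by
    have h1 := (hz' s).1 ((hz s).2 (.inl rfl))
    have h2 := (hs x).2 (.inl rfl)
    have h3 := (hs' x).1
    have h4 := (ht' x').2 (.inl rfl)
    have h5 := (hs x').1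
    grind
  subst key
  have e1 := (hz t).2 (.inr rfl)
  have e2 := (hz' t').2 (.inr rfl)
  rw [hz'] at e1
  rw [hz] at e2
  have f1 := (ht y).2 (.inr rfl)
  have f2 := (ht' y').2 (.inr rfl)
  have g1 := hs y
  have g2 := hs y'
  have g3 := hs' y
  have g4 := hs' y'
  have g5 := ht y'
  have g6 := ht' y
  grind

variable (hM : M ⊨ ZFA)
include hM

theorem exists_sep (P : M → Prop) [h : IsDefinable fun v : Fin 1 → M => P (v 0)] (a : M) :
    ∃ b, ∀ x, Mem x b ↔ Mem x a ∧ P x := by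
  obtain ⟨k, p, φ, hφ⟩ := exists_formula_finite h
  have := hM.realize_of_mem _ (IsAxiom.separation φ)
  simp only [separation, Sentence.Realize, BoundedFormula.realize_alls] at this
  have := this p
  simp only [BoundedFormula.realize_all, BoundedFormula.realize_ex, BoundedFormula.realize_iff,
    BoundedFormula.realize_inf, realize_mem, Fin.snoc_castSucc, Fin.snoc_last] at this
  obtain ⟨b, hb⟩ := this a
  refine ⟨b, fun x => (hb x).trans (and_congr Iff.rfl ?_)⟩
  rw [← hφ, BoundedFormula.realize_relabel]
  refine Eq.to_iff (congrArg₂ (BoundedFormula.Realize φ) ?_ (Subsingleton.elim _ _))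
  funext i
  rcases i with i | i
  · change Fin.snoc (α := fun _ => M) (Fin.snoc (Fin.snoc p a) b) x i.castSucc.castSucc.castSucc = _
    simp
  · exact Fin.snoc_last (α := fun _ => M) _ _


theorem ext {x y : M} (h : ∀ z, Mem z x ↔ Mem z y) : x = y := by
  have := hM.realize_of_mem _ IsAxiom.extensionality
  simp only [extensionality, Sentence.Realize, Formula.Realize, BoundedFormula.realize_all,
    BoundedFormula.realize_imp, BoundedFormula.realize_iff, realize_mem, realize_eq] at this
  exact this x y h

theorem exists_pair (x y : M) : ∃ z, IsPair z x y := by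
  have := hM.realize_of_mem _ IsAxiom.pairing
  simp only [pairing, Sentence.Realize, Formula.Realize, BoundedFormula.realize_all,
    BoundedFormula.realize_ex, realize_isPair] at this
  exact this x y

theorem exists_sUnion (x : M) : ∃ u, ∀ z, Mem z u ↔ ∃ y, Mem z y ∧ Mem y x := by
  have := hM.realize_of_mem _ IsAxiom.union
  simp only [union, Sentence.Realize, Formula.Realize, BoundedFormula.realize_all,
    BoundedFormula.realize_ex, BoundedFormula.realize_iff, BoundedFormula.realize_inf,
    realize_mem] at this
  exact this x

theorem exists_powerset (x : M) : ∃ u, ∀ z, Mem z u ↔ ∀ y, Mem y z → Mem y x := by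
  have := hM.realize_of_mem _ IsAxiom.powerSet
  simp only [powerSet, Sentence.Realize, Formula.Realize, BoundedFormula.realize_all,
    BoundedFormula.realize_ex, BoundedFormula.realize_iff, realize_mem, realize_subset] at this
  exact this x

theorem exists_inductive : ∃ a : M, (∃ z, (∀ w, ¬Mem w z) ∧ Mem z a) ∧
    ∀ x, Mem x a → ∃ y, IsSucc y x ∧ Mem y a := by
  have := hM.realize_of_mem _ IsAxiom.infinity
  simp only [infinity, Sentence.Realize, Formula.Realize, BoundedFormula.realize_all,
    BoundedFormula.realize_ex, BoundedFormula.realize_imp, BoundedFormula.realize_inf,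
    realize_mem, realize_isEmpty, realize_isSucc] at this
  exact this

theorem exists_solution {X A s : M} (hX : ∀ y, ¬(Mem y X ∧ Mem y A)) (hs : IsFunction s X)
    (hsub : ∀ x t, Mem x X → PairMem s x t → ∀ y, Mem y t → Mem y X ∨ Mem y A) :
    ∃ f, IsFunction f X ∧ ∀ x t y, Mem x X → PairMem s x t → PairMem f x y → ∀ z, Mem z y ↔
        (∃ x', Mem x' t ∧ Mem x' X ∧ PairMem f x' z) ∨ (Mem z t ∧ Mem z A) := by
  have := hM.realize_of_mem _ IsAxiom.antiFoundation
  simp only [antiFoundation, Sentence.Realize, Formula.Realize, BoundedFormula.realize_all,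
    BoundedFormula.realize_ex, BoundedFormula.realize_imp, BoundedFormula.realize_inf,
    realize_isFlatSystem, realize_isSolution] at this
  obtain ⟨f, hf, -⟩ := this X A s ⟨hX, hs, hsub⟩
  exact ⟨f, hf⟩

theorem IsPair.unique {z z' x y : M} (h : IsPair z x y) (h' : IsPair z' x y) : z = z' :=
  ext hM fun w => (h w).trans (h' w).symm

theorem IsOrderedPair.unique {z z' x y : M} (h : IsOrderedPair z x y)
    (h' : IsOrderedPair z' x y) : z = z' := by
  obtain ⟨s, t, hs, ht, hz⟩ := h
  obtain ⟨s', t', hs', ht', hz'⟩ := h'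
  obtain rfl := hs.unique hM hs'
  obtain rfl := ht.unique hM ht'
  exact hz.unique hM hz'

theorem exists_orderedPair (x y : M) : ∃ z, IsOrderedPair z x y := by
  obtain ⟨s, hs⟩ := exists_pair hM x x
  obtain ⟨t, ht⟩ := exists_pair hM x y
  obtain ⟨z, hz⟩ := exists_pair hM s t
  exact ⟨z, s, t, hs, ht, hz⟩

theorem exists_union (x y : M) : ∃ u, ∀ z, Mem z u ↔ Mem z x ∨ Mem z y := by
  obtain ⟨p, hp⟩ := exists_pair hM x y
  obtain ⟨u, hu⟩ := exists_sUnion hM p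
  refine ⟨u, fun z => (hu z).trans ⟨?_, ?_⟩⟩
  · rintro ⟨w, hw, hwp⟩
    rcases (hp w).1 hwp with rfl | rfl <;> simp [hw]
  · rintro (h | h)
    · exact ⟨x, h, (hp x).2 (.inl rfl)⟩
    · exact ⟨y, h, (hp y).2 (.inr rfl)⟩

theorem exists_insert (x y : M) : ∃ u, ∀ z, Mem z u ↔ Mem z x ∨ z = y := by
  obtain ⟨p, hp⟩ := exists_pair hM y y
  obtain ⟨u, hu⟩ := exists_union hM x p
  exact ⟨u, fun z => (hu z).trans (or_congr Iff.rfl ((hp z).trans (or_self_iff)))⟩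

/-- Outside every set there is a set without double-membership neighbours. -/
theorem exists_notMem_isolated (a : M) :
    ∃ w, ¬Mem w a ∧ ∀ t, ¬(Mem w t ∧ Mem t w) := by
  -- A variant of Russell's set: a `D`-neighbour of `w` would be an element of `w`, hence have no
  -- `D`-neighbours.
  obtain ⟨w, hw⟩ := exists_sep hM (fun z => ¬∃ t, Mem z t ∧ Mem t z) a
  have h : ∀ t, ¬(Mem w t ∧ Mem t w) := fun t ht => ((hw t).1 ht.2).2 ⟨w, ht.2, ht.1⟩
  exact ⟨w, fun hwa => h w ⟨(hw w).2 ⟨hwa, not_exists.2 h⟩, (hw w).2 ⟨hwa, not_exists.2 h⟩⟩, h⟩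

/-- Every definable system of equations `F x = {F x' | E x' x} ∪ {z ∈ T | Q z x}`, indexed by the
elements `x` of a set, has a definable solution. -/
theorem exists_solution_of_definable (X T : M) (E Q : M → M → Prop)
    [IsDefinable₂ E] [IsDefinable₂ Q] :
    ∃ F : M → M, IsDefinable₂ (fun x y => Mem x X ∧ y = F x) ∧
      ∀ x, Mem x X → ∀ z, Mem z (F x) ↔
        (∃ x', Mem x' X ∧ E x' x ∧ z = F x') ∨ (Mem z T ∧ Q z x) := by
  obtain ⟨U, hU⟩ := exists_sUnion hM T
  obtain ⟨v, hvU, -⟩ := exists_notMem_isolated hM U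
  -- The indeterminate standing for `x` is `{v, x}`. As `v` lies in no element of `T`, no
  -- indeterminate is a constant.
  choose c hc using exists_pair hM v
  have hcinj : ∀ x y, c x = c y → x = y := fun x y h =>
    isPair_right_injective (hc x) (h ▸ hc y)
  have hceq : ∀ z x, IsPair z v x ↔ z = c x := fun z x =>
    ⟨fun h => h.unique hM (hc x), fun h => h ▸ hc x⟩
  obtain ⟨X₁, hX₁⟩ := exists_insert hM X v
  obtain ⟨X₂, hX₂⟩ := exists_powerset hM X₁
  obtain ⟨X', hX'⟩ := exists_sep hM (fun t => ∃ x, Mem x X ∧ IsPair t v x) X₂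
  replace hX' : ∀ t, Mem t X' ↔ ∃ x, Mem x X ∧ t = c x := by
    intro t
    simp only [hX', hX₂, hX₁, hceq]
    refine and_iff_right_of_imp ?_
    rintro ⟨x, hx, rfl⟩ y hy
    rcases (hc x y).1 hy with rfl | rfl <;> simp [hx]
  obtain ⟨W, hW⟩ := exists_union hM X' T
  have hS : ∀ x, ∃ s, ∀ z, Mem z s ↔
      (∃ y, Mem y X ∧ E y x ∧ IsPair z v y) ∨ (Mem z T ∧ Q z x) := by
    intro x
    obtain ⟨s, hs⟩ := exists_sep hM
      (fun z => (∃ y, Mem y X ∧ E y x ∧ IsPair z v y) ∨ (Mem z T ∧ Q z x)) W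
    refine ⟨s, fun z => (hs z).trans (and_iff_right_of_imp ?_)⟩
    rw [hW, hX']
    rintro (⟨y, hy, -, hz⟩ | h)
    · exact .inl ⟨y, hy, (hceq _ _).1 hz⟩
    · exact .inr h.1
  choose S hS using hS
  obtain ⟨W₁, hW₁⟩ := exists_powerset hM W
  obtain ⟨W₂, hW₂⟩ := exists_union hM X' W₁
  -- `W₂` contains all indeterminates and right-hand sides, so its double power set contains the
  -- Kuratowski pairs that make up the system.
  obtain ⟨W₃, hW₃⟩ := exists_powerset hM W₂
  obtain ⟨W₄, hW₄⟩ := exists_powerset hM W₃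
  obtain ⟨s, hs⟩ := exists_sep hM (fun p => ∃ x, Mem x X ∧ ∃ x', IsPair x' v x ∧
    ∃ t, IsOrderedPair p x' t ∧ ∀ z, Mem z t ↔
      (∃ y, Mem y X ∧ E y x ∧ IsPair z v y) ∨ (Mem z T ∧ Q z x)) W₄
  replace hs : ∀ p, Mem p s ↔ ∃ x, Mem x X ∧ IsOrderedPair p (c x) (S x) := by
    intro p
    rw [hs]
    constructor
    · rintro ⟨-, x, hx, x', hx', t, hp, ht⟩
      obtain rfl := (hceq _ _).1 hx'
      obtain rfl : t = S x := ext hM fun z => (ht z).trans (hS x z).symm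
      exact ⟨x, hx, hp⟩
    · rintro ⟨x, hx, hp⟩
      refine ⟨?_, x, hx, c x, hc x, S x, hp, hS x⟩
      have hx' : Mem (c x) W₂ := (hW₂ _).2 (.inl ((hX' _).2 ⟨x, hx, rfl⟩))
      have hSx : Mem (S x) W₂ := by
        refine (hW₂ _).2 (.inr ((hW₁ _).2 fun z hz => ?_))
        rcases (hS x z).1 hz with ⟨y, hy, -, hz⟩ | h
        · exact (hW _).2 (.inl ((hX' _).2 ⟨y, hy, (hceq _ _).1 hz⟩))
        · exact (hW _).2 (.inr h.1)
      obtain ⟨q, r, hq, hr, hp⟩ := hp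
      refine (hW₄ _).2 fun y hy => (hW₃ _).2 fun z hz => ?_
      rcases (hp y).1 hy with rfl | rfl
      · rcases (hq z).1 hz with rfl | rfl <;> exact hx'
      · rcases (hr z).1 hz with rfl | rfl <;> assumption
  have hps : ∀ x t, Mem x X → (PairMem s (c x) t ↔ t = S x) := by
    intro x t hx
    constructor
    · rintro ⟨p, hp, hps⟩
      obtain ⟨x', -, hp'⟩ := (hs p).1 hps
      obtain ⟨h, rfl⟩ := hp.injective hp'
      rw [hcinj _ _ h]
    · rintro rfl
      obtain ⟨p, hp⟩ := exists_orderedPair hM (c x) (S x)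
      exact ⟨p, hp, (hs p).2 ⟨x, hx, hp⟩⟩
  obtain ⟨f, hf, hsol⟩ := exists_solution hM (X := X') (A := T) (s := s) (by
      rintro y ⟨hy, hyT⟩
      obtain ⟨x, -, rfl⟩ := (hX' y).1 hy
      exact hvU ((hU v).2 ⟨_, (hc x v).2 (.inl rfl), hyT⟩))
    (by
      refine ⟨fun p hp => ?_, fun x' hx' => ?_⟩
      · obtain ⟨x, hx, hp⟩ := (hs p).1 hp
        exact ⟨_, _, (hX' _).2 ⟨x, hx, rfl⟩, hp⟩
      · obtain ⟨x, hx, rfl⟩ := (hX' x').1 hx'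
        exact ⟨S x, fun z => hps x z hx⟩)
    (by
      intro x' t hx' ht y hy
      obtain ⟨x, hx, rfl⟩ := (hX' x').1 hx'
      obtain rfl := (hps x t hx).1 ht
      rcases (hS x y).1 hy with ⟨z, hz, -, hyz⟩ | h
      · exact .inl ((hX' _).2 ⟨z, hz, (hceq _ _).1 hyz⟩)
      · exact .inr h.1)
  have hF : ∀ x, ∃ y, Mem x X → ∀ z, PairMem f (c x) z ↔ z = y := by
    intro x
    by_cases hx : Mem x X
    · obtain ⟨y, hy⟩ := hf.2 (c x) ((hX' _).2 ⟨x, hx, rfl⟩)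
      exact ⟨y, fun _ => hy⟩
    · exact ⟨x, fun h => absurd h hx⟩
  choose F hF using hF
  refine ⟨F, ⟨fun s t _ _ => ?_⟩, fun x hx z => ?_⟩
  -- `F` comes from external choice, but over `X` its graph is read off from the solution set `f`.
  · have : (fun v' => Mem (s v') X ∧ t v' = F (s v')) =
        fun v' => Mem (s v') X ∧ ∃ x', IsPair x' v (s v') ∧ PairMem f x' (t v') := by
      funext v'
      refine propext (and_congr_right fun h => ?_)
      simp [hceq, hF _ h]
    rw [this]
    infer_instance
  · rw [hsol (c x) (S x) (F x) ((hX' _).2 ⟨x, hx, rfl⟩) ((hps x _ hx).2 rfl) ((hF x hx _).2 rfl)]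
    constructor
    · rintro (⟨x', hx's, hx', hz⟩ | ⟨hz, hzT⟩)
      · obtain ⟨y, hy, rfl⟩ := (hX' x').1 hx'
        rcases (hS x _).1 hx's with ⟨y', hy', hE, h⟩ | ⟨hT, -⟩
        · obtain rfl := hcinj _ _ ((hceq _ _).1 h)
          exact .inl ⟨y, hy, hE, (hF y hy z).1 hz⟩
        · exact absurd ((hU v).2 ⟨_, (hc y v).2 (.inl rfl), hT⟩) hvU
      · rcases (hS x _).1 hz with ⟨y, -, -, h⟩ | h
        · obtain rfl := (hceq _ _).1 h
          exact absurd ((hU v).2 ⟨_, (hc y v).2 (.inl rfl), hzT⟩) hvU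
        · exact .inr h
    · rintro (⟨y, hy, hE, rfl⟩ | h)
      · exact .inl ⟨c y, (hS x _).2 (.inl ⟨y, hy, hE, hc y⟩), (hX' _).2 ⟨y, hy, rfl⟩,
          (hF y hy _).2 rfl⟩
      · exact .inr ⟨(hS x _).2 (.inr h), h.1⟩

/-- Every definable digraph on a set has a copy among sets outside a given set `T`, with
prescribed elements in `T`, and closed under double-membership neighbours. -/
theorem exists_copy (X T : M) (E Q : M → M → Prop) [IsDefinable₂ E] [IsDefinable₂ Q] :
    ∃ F : M → M, IsDefinable₂ (fun x y => Mem x X ∧ y = F x) ∧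
      (∀ x, Mem x X → ¬Mem (F x) T ∧ ∀ t, Mem t T → ¬Mem (F x) t) ∧
      (∀ x x', Mem x X → Mem x' X → F x = F x' → x = x') ∧
      (∀ x x', Mem x X → Mem x' X → (Mem (F x) (F x') ↔ E x x')) ∧
      (∀ x t, Mem x X → Mem t T → (Mem t (F x) ↔ Q t x)) ∧
      ∀ x z, Mem x X → Mem z (F x) → Mem (F x) z → ∃ x', Mem x' X ∧ z = F x' := by
  obtain ⟨U, hU⟩ := exists_sUnion hM T
  obtain ⟨v, hvU, -⟩ := exists_notMem_isolated hM U
  obtain ⟨X₁, hX₁⟩ := exists_insert hM X v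
  obtain ⟨X₂, hX₂⟩ := exists_powerset hM X₁
  have hpair : ∀ x z, Mem x X → IsPair z v x → Mem z X₂ := by
    intro x z hx hz
    refine (hX₂ _).2 fun y hy => (hX₁ _).2 ?_
    rcases (hz y).1 hy with rfl | rfl <;> simp [hx]
  obtain ⟨W₁, hW₁⟩ := exists_union hM T U
  obtain ⟨W₂, hW₂⟩ := exists_union hM X₁ X₂
  obtain ⟨W, hW⟩ := exists_union hM W₁ W₂
  obtain ⟨W', hW'⟩ := exists_sUnion hM W
  obtain ⟨Y, hY⟩ := exists_union hM W W'
  -- Each `F x` will contain `w` as a marker. Since `w` is not in `⋃ W`, this keeps `F x` out of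
  -- `W`, hence away from `T`, `⋃ T`, `X`, `v` and the tags `{v, x}`. Since `w` is isolated, it
  -- creates no `D`-edge.
  obtain ⟨w, hwY, hw⟩ := exists_notMem_isolated hM Y
  obtain ⟨T₁, hT₁⟩ := exists_union hM T X₂
  obtain ⟨T', hT'⟩ := exists_insert hM T₁ w
  -- The elements of `F x` besides its copied `E`-predecessors: the prescribed ones, a tag `{v, x}`
  -- making `F` injective, and the marker.
  have : IsDefinable₂ fun z x => (Mem z T ∧ Q z x) ∨ IsPair z v x ∨ z = w :=
    ⟨fun s t _ _ => inferInstance⟩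
  obtain ⟨F, hFdef, hF⟩ := exists_solution_of_definable hM X T' E
    fun z x => (Mem z T ∧ Q z x) ∨ IsPair z v x ∨ z = w
  replace hF : ∀ x, Mem x X → ∀ z, Mem z (F x) ↔
      (∃ x', Mem x' X ∧ E x' x ∧ z = F x') ∨ (Mem z T ∧ Q z x) ∨ IsPair z v x ∨ z = w := by
    intro x hx z
    rw [hF x hx, hT', hT₁]
    refine or_congr Iff.rfl (and_iff_right_of_imp ?_)
    rintro (h | h | h)
    · exact .inl (.inl h.1)
    · exact .inl (.inr (hpair x z hx h))
    · exact .inr h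
  have hwF : ∀ x, Mem x X → Mem w (F x) := fun x hx =>
    (hF x hx w).2 (.inr (.inr (.inr rfl)))
  have hFW : ∀ x, Mem x X → ¬Mem (F x) W := fun x hx h =>
    hwY ((hY w).2 (.inr ((hW' w).2 ⟨_, hwF x hx, h⟩)))
  simp only [hW, hW₁, hW₂, hX₁, hU, not_or] at hFW
  have hwW : ¬Mem w W := fun h => hwY ((hY w).2 (.inl h))
  simp only [hW, hW₁, hW₂, not_or] at hwW
  have hFpair : ∀ x x', Mem x X → Mem x' X → ¬IsPair (F x) v x' := fun x x' hx hx' h =>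
    (hFW x hx).2.2 (hpair x' _ hx' h)
  have hFw : ∀ x, Mem x X → F x ≠ w := fun x hx h =>
    hw w ⟨by simpa [h] using hwF x hx, by simpa [h] using hwF x hx⟩
  have hvp : ∀ t x, Mem t T → ¬IsPair t v x := fun t x ht h =>
    hvU ((hU v).2 ⟨t, (h v).2 (.inl rfl), ht⟩)
  have hinj : ∀ x x', Mem x X → Mem x' X → F x = F x' → x = x' := by
    intro x x' hx hx' h
    obtain ⟨z, hz⟩ := exists_pair hM v x
    have hzF : Mem z (F x') := h ▸ (hF x hx z).2 (.inr (.inr (.inl hz)))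
    rcases (hF x' hx' z).1 hzF with ⟨y, hy, -, rfl⟩ | h | h | rfl
    · exact absurd hz (hFpair _ _ hy hx)
    · exact absurd hz (hvp _ _ h.1)
    · exact isPair_right_injective hz h
    · exact absurd (hpair _ _ hx hz) hwW.2.2
  refine ⟨F, hFdef, fun x hx => ⟨(hFW x hx).1.1, fun t ht h => (hFW x hx).1.2 ⟨t, h, ht⟩⟩, hinj,
    fun x x' hx hx' => ?_, fun x t hx ht => ?_, fun x z hx hz hz' => ?_⟩
  · rw [hF x' hx']
    constructor
    · rintro (⟨y, hy, hE, h⟩ | h | h | h)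
      · rwa [hinj _ _ hx hy h]
      · exact absurd h.1 (hFW x hx).1.1
      · exact absurd h (hFpair _ _ hx hx')
      · exact absurd h (hFw x hx)
    · exact fun h => .inl ⟨x, hx, h, rfl⟩
  · rw [hF x hx]
    constructor
    · rintro (⟨y, hy, -, rfl⟩ | h | h | rfl)
      · exact absurd ht (hFW y hy).1.1
      · exact h.2
      · exact absurd h (hvp _ _ ht)
      · exact absurd ht hwW.1.1
    · exact fun h => .inr (.inl ⟨ht, h⟩)
  · rcases (hF x hx z).1 hz with ⟨y, hy, -, rfl⟩ | h | h | rfl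
    · exact ⟨y, hy, rfl⟩
    · exact absurd ⟨z, hz', h.1⟩ (hFW x hx).1.2
    · rcases (h _).1 hz' with h | h
      · exact absurd h (hFW x hx).2.1.2
      · exact absurd (h.symm ▸ hx) (hFW x hx).2.1.1
    · exact absurd ⟨hz, hz'⟩ (hw _)

end SetTheory

/-! ### Bounded reachability along a relation. -/

section Reach

variable {α : Type*} {D : α → α → Prop}

/-- `y` can be reached from `x` in at most `r` steps along `D`. -/
def Reach (D : α → α → Prop) : ℕ → α → α → Prop
  | 0, x, y => x = y
  | r + 1, x, y => ∃ z, Reach D r x z ∧ (z = y ∨ D z y)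

theorem Reach.mono {r s : ℕ} {x y : α} (hrs : r ≤ s) (h : Reach D r x y) : Reach D s x y := by
  induction hrs with
  | refl => exact h
  | step _ ih => exact ⟨y, ih, .inl rfl⟩

theorem Reach.refl (r : ℕ) (x : α) : Reach D r x x := Reach.mono (Nat.zero_le r) rfl

theorem Reach.trans {r s : ℕ} {x y z : α} (h : Reach D r x y) (h' : Reach D s y z) :
    Reach D (r + s) x z := by
  induction s generalizing z with
  | zero => obtain rfl := h'; exact h
  | succ s ih => obtain ⟨w, hw, hwz⟩ := h'; exact ⟨w, ih hw, hwz⟩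

theorem Reach.symm (hD : ∀ x y, D x y → D y x) {r : ℕ} {x y : α} (h : Reach D r x y) :
    Reach D r y x := by
  induction r generalizing y with
  | zero => exact Eq.symm h
  | succ r ih =>
    obtain ⟨z, hz, hzy⟩ := h
    have h1 : Reach D 1 y z := ⟨y, rfl, hzy.imp Eq.symm (hD _ _)⟩
    exact Nat.add_comm 1 r ▸ h1.trans (ih hz)

theorem Reach.map {β : Type*} {D' : β → β → Prop} {f : α → β}
    (hf : ∀ x y, D x y → D' (f x) (f y)) {r : ℕ} {x y : α} (h : Reach D r x y) :
    Reach D' r (f x) (f y) := by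
  induction r generalizing y with
  | zero => exact congrArg f h
  | succ r ih =>
    obtain ⟨z, hz, hzy⟩ := h
    exact ⟨f z, ih hz, hzy.imp (congrArg f) (hf _ _)⟩

/-- All points which can be reached from `x` along `D` can be reached in at most `r` steps. -/
def Bounded (D : α → α → Prop) (r : ℕ) (x : α) : Prop :=
  ∀ y, Reach D (r + 1) x y → Reach D r x y

/-- Once one further step adds nothing to the ball, no number of steps does. -/
theorem Bounded.reach {r : ℕ} {x : α} (h : Bounded D r x) {s : ℕ} {y : α} (hy : Reach D s x y) :
    Reach D r x y := by
  induction s generalizing y with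
  | zero => obtain rfl := hy; exact .refl r x
  | succ s ih => obtain ⟨z, hz, hzy⟩ := hy; exact h y ⟨z, ih hz, hzy⟩

theorem Bounded.of_reach (hD : ∀ x y, D x y → D y x) {r s : ℕ} {x y : α} (h : Bounded D r x)
    (hy : Reach D s x y) : Bounded D (s + r) y := fun _ hz =>
  (hy.symm hD).trans (h.reach (hy.trans hz))

end Reach

/-! ### Double membership, numerals and an unbounded point. -/

section DoubleMembership

variable {M : Type u} [LSet.Structure M]

/-- The relation `x ∈ y ∨ y ∈ x`. -/
def SMem (x y : M) : Prop := Mem x y ∨ Mem y x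

/-- The relation `x ∈ y ∧ y ∈ x`. -/
def DMem (x y : M) : Prop := Mem x y ∧ Mem y x

theorem SMem.symm {x y : M} (h : SMem x y) : SMem y x := Or.symm h

theorem DMem.symm {x y : M} (h : DMem x y) : DMem y x := And.symm h

instance SMem.isDefinable : IsDefinable₂ (SMem (M := M)) :=
  ⟨fun s t _ _ => by unfold SMem; infer_instance⟩

instance DMem.isDefinable : IsDefinable₂ (DMem (M := M)) :=
  ⟨fun s t _ _ => by unfold DMem; infer_instance⟩

instance Reach.isDefinable (r : ℕ) : IsDefinable₂ (Reach (DMem (M := M)) r) := by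
  induction r with
  | zero => exact ⟨fun s t _ _ => IsDefinable.eq s t⟩
  | succ r ih => exact ⟨fun s t _ _ => by unfold Reach; infer_instance⟩

/-- The sequence `g` lists only the standard numerals and is built outside the model; `I` may have
other elements. -/
theorem exists_nat (hM : M ⊨ ZFA) : ∃ (I : M) (g : ℕ → M),
    (∀ w, ¬Mem w (g 0)) ∧ (∀ n, IsSucc (g (n + 1)) (g n)) ∧ ∀ n, Mem (g n) I := by
  obtain ⟨I, ⟨z, hz, hzI⟩, hI⟩ := exists_inductive hM
  choose f hf hfI using fun x : {x // Mem x I} => hI x x.2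
  let g : ℕ → {x // Mem x I} := fun n => n.rec ⟨z, hzI⟩ fun _ x => ⟨f x, hfI x⟩
  exact ⟨I, fun n => (g n).1, hz, fun n => hf (g n), fun n => (g n).2⟩

section Nat

variable {g : ℕ → M} (h0 : ∀ w, ¬Mem w (g 0)) (hg : ∀ n, IsSucc (g (n + 1)) (g n))
include h0 hg

theorem mem_nat_iff {n : ℕ} {z : M} : Mem z (g n) ↔ ∃ m < n, z = g m := by
  induction n with
  | zero => simp [h0]
  | succ n ih =>
    rw [hg n, ih]
    constructor
    · rintro (⟨m, hm, rfl⟩ | rfl)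
      · exact ⟨m, by omega, rfl⟩
      · exact ⟨n, by omega, rfl⟩
    · rintro ⟨m, hm, rfl⟩
      rcases Nat.lt_succ_iff_lt_or_eq.1 hm with h | rfl
      · exact .inl ⟨m, h, rfl⟩
      · exact .inr rfl

/-- Foundation is unavailable, so induction on the external index replaces it. -/
theorem notMem_nat_self (n : ℕ) : ¬Mem (g n) (g n) := by
  induction n using Nat.strong_induction_on with
  | _ n ih =>
    intro h
    obtain ⟨m, hm, e⟩ := (mem_nat_iff h0 hg).1 h
    exact ih m hm (e ▸ h)

theorem nat_injective : Function.Injective g := by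
  intro m n h
  rcases lt_trichotomy m n with hl | rfl | hl
  · exact absurd ((mem_nat_iff h0 hg).2 ⟨m, hl, h.symm⟩) (notMem_nat_self h0 hg n)
  · rfl
  · exact absurd ((mem_nat_iff h0 hg).2 ⟨n, hl, h⟩) (notMem_nat_self h0 hg m)

theorem eq_nat_of_isSucc {n : ℕ} {y : M} (h : IsSucc (g n) y) : ∃ m, n = m + 1 ∧ y = g m := by
  obtain ⟨m, hm, rfl⟩ := (mem_nat_iff h0 hg).1 ((h y).2 (.inr rfl))
  refine ⟨m, le_antisymm (not_lt.1 fun hl => ?_) hm, rfl⟩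
  rcases (h (g (m + 1))).1 ((mem_nat_iff h0 hg).2 ⟨_, hl, rfl⟩) with h | h
  · obtain ⟨k, hk, e⟩ := (mem_nat_iff h0 hg).1 h
    have := nat_injective h0 hg e
    omega
  · have := nat_injective h0 hg h
    omega

end Nat

theorem infinite_of_models (hM : M ⊨ ZFA) : Infinite M := by
  obtain ⟨I, g, h0, hg, -⟩ := exists_nat hM
  exact .of_injective g (nat_injective h0 hg)

/-- Symmetrised succession on `I` is copied as a `D`-graph. Successor-neighbours of numerals are
numerals of adjacent index, so the other elements of `I` are never reached from the copy of `g 0`,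
and the copy of `g (r + 1)` is not reached in `r` steps. -/
theorem exists_not_bounded (hM : M ⊨ ZFA) : ∃ x : M, ∀ r, ¬Bounded DMem r x := by
  obtain ⟨I, g, h0, hg, hI⟩ := exists_nat hM
  have : IsDefinable₂ fun x y : M => IsSucc x y ∨ IsSucc y x := ⟨fun s t _ _ => inferInstance⟩
  have : IsDefinable₂ fun _ _ : M => False := ⟨fun s t _ _ => inferInstance⟩
  obtain ⟨F, -, -, hinj, hE, -, hD⟩ :=
    exists_copy hM I I (fun x y => IsSucc x y ∨ IsSucc y x) fun _ _ => False
  have h1 : ∀ n, Reach DMem n (F (g 0)) (F (g n)) := fun n => by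
    induction n with
    | zero => rfl
    | succ n ih =>
      exact ⟨_, ih, .inr ⟨(hE _ _ (hI _) (hI _)).2 (.inr (hg n)),
        (hE _ _ (hI _) (hI _)).2 (.inl (hg n))⟩⟩
  have h2 : ∀ r y, Reach DMem r (F (g 0)) y → ∃ m ≤ r, y = F (g m) := fun r => by
    induction r with
    | zero => rintro y rfl; exact ⟨0, le_rfl, rfl⟩
    | succ r ih =>
      rintro y ⟨z, hz, hzy⟩
      obtain ⟨m, hm, rfl⟩ := ih z hz
      rcases hzy with rfl | h
      · exact ⟨m, by omega, rfl⟩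
      · obtain ⟨x, hx, rfl⟩ := hD _ _ (hI m) h.2 h.1
        rcases (hE _ _ (hI m) hx).1 h.1 with h | h
        · obtain ⟨k, rfl, rfl⟩ := eq_nat_of_isSucc h0 hg h
          exact ⟨k, by omega, rfl⟩
        · refine ⟨m + 1, by omega, congrArg F (ext hM fun w => ?_)⟩
          rw [h, hg]
  refine ⟨F (g 0), fun r hr => ?_⟩
  obtain ⟨m, hm, h⟩ := h2 r _ (hr _ (h1 (r + 1)))
  have := nat_injective h0 hg (hinj _ _ (hI _) (hI _) h)
  omega

end DoubleMembership

/-! ### Local isomorphisms and their one-point extensions. -/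

section BackAndForth

variable {M : Type u} [LSet.Structure M] {n : ℕ} {r : ℕ} {a b : Fin n → M} {G : M → M → Prop}

/-- `x, x'` and `y, y'` satisfy the same atomic formulas about equality, `S` and `D`. -/
def SameType (x x' y y' : M) : Prop :=
  (x = x' ↔ y = y') ∧ (SMem x x' ↔ SMem y y') ∧ (DMem x x' ↔ DMem y y')

theorem SameType.swap {x x' y y' : M} (h : SameType x x' y y') : SameType x' x y' y :=
  ⟨by rw [eq_comm, h.1, eq_comm],
    ⟨fun hs => (h.2.1.1 hs.symm).symm, fun hs => (h.2.1.2 hs.symm).symm⟩,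
    ⟨fun hs => (h.2.2.1 hs.symm).symm, fun hs => (h.2.2.2 hs.symm).symm⟩⟩

/-- `G` is a definable partial isomorphism of SD-graphs which maps `a` to `b`, and the ball of
radius `r` about `a` onto that about `b`. -/
structure IsLocalIso (r : ℕ) (a b : Fin n → M) (G : M → M → Prop) : Prop where
  isDefinable : IsDefinable₂ G
  sameType : ∀ {x x' y y'}, G x y → G x' y' → SameType x x' y y'
  apply : ∀ i, G (a i) (b i)
  exists_right : ∀ {i x}, Reach DMem r (a i) x → ∃ y, G x y
  exists_left : ∀ {i y}, Reach DMem r (b i) y → ∃ x, G x y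

namespace IsLocalIso

theorem refl (r : ℕ) (a : Fin n → M) : IsLocalIso r a a Eq where
  isDefinable := ⟨fun s t _ _ => inferInstance⟩
  sameType := by rintro _ _ _ _ rfl rfl; exact ⟨Iff.rfl, Iff.rfl, Iff.rfl⟩
  apply _ := rfl
  exists_right _ := ⟨_, rfl⟩
  exists_left _ := ⟨_, rfl⟩

theorem symm (h : IsLocalIso r a b G) : IsLocalIso r b a fun x y => G y x where
  isDefinable := ⟨fun s t _ _ => h.isDefinable.comp t s⟩
  sameType h1 h2 := ⟨(h.sameType h1 h2).1.symm, (h.sameType h1 h2).2.1.symm,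
    (h.sameType h1 h2).2.2.symm⟩
  apply := h.apply
  exists_right := h.exists_left
  exists_left := h.exists_right

theorem mono {s : ℕ} (h : IsLocalIso r a b G) (hs : s ≤ r) : IsLocalIso s a b G where
  isDefinable := h.isDefinable
  sameType := h.sameType
  apply := h.apply
  exists_right h' := h.exists_right (h'.mono hs)
  exists_left h' := h.exists_left (h'.mono hs)

/-- A path of length at most `r` from `a i` stays inside the domain of `G` and can be transported
step by step. -/
theorem reach {s : ℕ} (h : IsLocalIso r a b G) (hs : s ≤ r) {i : Fin n} {x y : M}
    (hx : Reach DMem s (a i) x) (hxy : G x y) : Reach DMem s (b i) y := by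
  induction s generalizing x y with
  | zero => exact (h.sameType (h.apply i) hxy).1.1 hx
  | succ s ih =>
    obtain ⟨z, hz, hzx⟩ := hx
    obtain ⟨w, hw⟩ := h.exists_right (hz.mono (by omega))
    have := h.sameType hw hxy
    exact ⟨w, ih (by omega) hz hw, hzx.imp this.1.1 this.2.2.1⟩

/-- The relation `G` itself still works: the `r`-ball about `c` lies within `(2 * r + 1) + r` steps
of `a i`. -/
theorem snoc_of_reach {i : Fin n} {c d : M} (h : IsLocalIso (3 * r + 1) a b G)
    (hc : Reach DMem (2 * r + 1) (a i) c) (hcd : G c d) :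
    IsLocalIso r (Fin.snoc (α := fun _ => M) a c) (Fin.snoc (α := fun _ => M) b d) G where
  isDefinable := h.isDefinable
  sameType := h.sameType
  apply j := by
    refine Fin.lastCases ?_ (fun j => ?_) j
    · simpa using hcd
    · simpa using h.apply j
  exists_right {j x} hx := by
    revert hx
    refine Fin.lastCases ?_ (fun j => ?_) j
    · rw [Fin.snoc_last]
      exact fun hx => h.exists_right ((hc.trans hx).mono (by omega))
    · rw [Fin.snoc_castSucc]
      exact fun hx => h.exists_right (hx.mono (by omega))
  exists_left {j x} hx := by
    revert hx
    have hd := h.reach (by omega) hc hcd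
    refine Fin.lastCases ?_ (fun j => ?_) j
    · rw [Fin.snoc_last]
      exact fun hx => h.exists_left ((hd.trans hx).mono (by omega))
    · rw [Fin.snoc_castSucc]
      exact fun hx => h.exists_left (hx.mono (by omega))

end IsLocalIso

theorem exists_range (hM : M ⊨ ZFA) (a : Fin n → M) : ∃ B, ∀ i, Mem (a i) B := by
  induction n with
  | zero => exact ⟨(infinite_of_models hM).nonempty.some, fun i => i.elim0⟩
  | succ n ih =>
    obtain ⟨B, hB⟩ := ih fun i => a i.castSucc
    obtain ⟨B', hB'⟩ := exists_insert hM B (a (Fin.last n))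
    refine ⟨B', Fin.lastCases ((hB' _).2 (.inr rfl)) fun i => (hB' _).2 (.inl (hB i))⟩

theorem exists_ball (hM : M ⊨ ZFA) (a : Fin n → M) (r : ℕ) :
    ∃ B, ∀ x, Mem x B ↔ ∃ i, Reach DMem r (a i) x := by
  have key : ∃ B, ∀ x, (∃ i, Reach DMem r (a i) x) → Mem x B := by
    induction r with
    | zero =>
      obtain ⟨B, hB⟩ := exists_range hM a
      exact ⟨B, by rintro _ ⟨i, rfl⟩; exact hB i⟩
    | succ r ih =>
      obtain ⟨B, hB⟩ := ih
      obtain ⟨U, hU⟩ := exists_sUnion hM B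
      obtain ⟨C, hC⟩ := exists_union hM B U
      refine ⟨C, ?_⟩
      rintro x ⟨i, z, hz, rfl | h⟩
      · exact (hC _).2 (.inl (hB _ ⟨i, hz⟩))
      -- A `D`-neighbour of `z` is an element of `z`, so one more step stays within `B ∪ ⋃ B`.
      · exact (hC _).2 (.inr ((hU _).2 ⟨z, h.2, hB _ ⟨i, hz⟩⟩))
  obtain ⟨B, hB⟩ := key
  have : IsDefinable fun v : Fin 1 → M => ∃ i, Reach DMem r (a i) (v 0) :=
    .finite_ex _ fun i => inferInstance
  obtain ⟨C, hC⟩ := exists_sep hM (fun x => ∃ i, Reach DMem r (a i) x) B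
  exact ⟨C, fun x => (hC x).trans (and_iff_right_of_imp (hB x))⟩

/-- The ball about `c` is copied with its membership relation, and the copies receive as elements
the `G`-images of their `S`-neighbours near `a`. The copy is closed under `D`-neighbours, so its
centre is bounded even when `c` is not. -/
theorem IsLocalIso.exists_snoc_of_not_reach (hM : M ⊨ ZFA) (h : IsLocalIso r a b G) {c : M}
    (hc : ∀ i, ¬Reach DMem (2 * r + 1) (a i) c) :
    ∃ d, Bounded DMem r d ∧ ∃ G' : M → M → Prop,
      IsLocalIso r (Fin.snoc (α := fun _ => M) a c) (Fin.snoc (α := fun _ => M) b d) G' := by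
  obtain ⟨A, hA⟩ := exists_ball hM a r
  obtain ⟨T, hT⟩ := exists_ball hM b r
  obtain ⟨X, hX⟩ := exists_ball hM (fun _ : Fin 1 => c) r
  replace hX : ∀ x, Mem x X ↔ Reach DMem r c x := by simpa using hX
  have := h.isDefinable
  have : IsDefinable₂ (Mem (M := M)) := ⟨fun s t _ _ => inferInstance⟩
  have : IsDefinable₂ fun t x => ∃ x', Mem x' A ∧ SMem x' x ∧ G x' t :=
    ⟨fun s t _ _ => inferInstance⟩
  obtain ⟨F, hdef, hnew, hinj, hmem, hQ, hD⟩ :=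
    exists_copy hM X T Mem fun t x => ∃ x', Mem x' A ∧ SMem x' x ∧ G x' t
  -- The bound `2 * r + 1` is `r` steps from `a i`, one edge across, and `r` steps to `c`.
  have hAX : ∀ x x', Mem x A → Mem x' X → ¬(x = x' ∨ DMem x x') := by
    intro x x' hx hx' hxx'
    obtain ⟨i, hi⟩ := (hA x).1 hx
    have h1 : Reach DMem (r + 1) (a i) x' := ⟨x, hi, hxx'⟩
    exact hc i ((h1.trans (((hX x').1 hx').symm fun _ _ => DMem.symm)).mono (by omega))
  have hGT : ∀ x y, Mem x A → G x y → Mem y T := by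
    intro x y hx hxy
    obtain ⟨i, hi⟩ := (hA x).1 hx
    exact (hT y).2 ⟨i, h.reach le_rfl hi hxy⟩
  have hcX : Mem c X := (hX c).2 (.refl r c)
  have hDF : ∀ x x', Mem x X → Mem x' X → (DMem (F x) (F x') ↔ DMem x x') := fun x x' hx hx' =>
    and_congr (hmem _ _ hx hx') (hmem _ _ hx' hx)
  -- Between the two balls only `S` can hold. Its direction is irrelevant, so it can always be
  -- realised as membership of `y` in `F x'`, never conversely, which excludes `D`.
  have hcross : ∀ x x' y, Mem x A → Mem x' X → G x y → SameType x x' y (F x') := by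
    intro x x' y hx hx' hxy
    have h1 := not_or.1 (hAX x x' hx hx')
    have hyT := hGT x y hx hxy
    have h2 := hnew x' hx'
    refine ⟨iff_of_false h1.1 fun e => h2.1 (e ▸ hyT), ?_,
      iff_of_false h1.2 fun e => h2.2 y hyT e.2⟩
    rw [SMem, SMem, or_iff_left (h2.2 y hyT), hQ x' y hx' hyT]
    constructor
    · exact fun e => ⟨x, hx, e, hxy⟩
    · rintro ⟨x₁, -, e, hx₁⟩
      rwa [(h.sameType hx₁ hxy).1.2 rfl] at e
  have hreach : ∀ s ≤ r, ∀ x, Reach DMem s c x → Reach DMem s (F c) (F x) := by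
    intro s
    induction s with
    | zero => rintro - x rfl; rfl
    | succ s ih =>
      rintro hs x ⟨z, hz, hzx⟩
      refine ⟨F z, ih (by omega) z hz, hzx.imp (congrArg F) (hDF z x ?_ ?_).2⟩
      · exact (hX z).2 (hz.mono (by omega))
      · exact (hX x).2 (Reach.mono hs ⟨z, hz, hzx⟩)
  have hcomp : ∀ s y, Reach DMem s (F c) y → ∃ x, Mem x X ∧ y = F x := by
    intro s
    induction s with
    | zero => rintro y rfl; exact ⟨c, hcX, rfl⟩
    | succ s ih =>
      rintro y ⟨z, hz, hzy⟩
      obtain ⟨x, hx, rfl⟩ := ih z hz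
      rcases hzy with rfl | hzy
      · exact ⟨x, hx, rfl⟩
      · exact hD x y hx hzy.2 hzy.1
  -- `G` is cut down to `A`, since `S`-edges from its other points to `X` are not controlled.
  refine ⟨F c, fun y hy => ?_, fun x y => (Mem x A ∧ G x y) ∨ (Mem x X ∧ y = F x), ?_, ?_, ?_, ?_,
    ?_⟩
  · obtain ⟨x, hx, rfl⟩ := hcomp _ y hy
    exact hreach r le_rfl x ((hX x).1 hx)
  · refine ⟨fun s t _ _ => ?_⟩
    have := hdef.comp s t
    infer_instance
  · rintro x x' y y' (⟨hx, hxy⟩ | ⟨hx, rfl⟩) (⟨hx', hxy'⟩ | ⟨hx', rfl⟩)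
    · exact h.sameType hxy hxy'
    · exact hcross x x' y hx hx' hxy
    · exact (hcross x' x y' hx' hx hxy').swap
    · exact ⟨⟨congrArg F, hinj x x' hx hx'⟩,
        or_congr (hmem x x' hx hx').symm (hmem x' x hx' hx).symm, (hDF x x' hx hx').symm⟩
  · refine Fin.lastCases ?_ fun i => ?_
    · simp [hcX]
    · simpa using .inl ⟨(hA _).2 ⟨i, .refl r _⟩, h.apply i⟩
  · intro j x
    refine Fin.lastCases ?_ (fun i => ?_) j
    · rw [Fin.snoc_last]
      exact fun hx => ⟨F x, .inr ⟨(hX x).2 hx, rfl⟩⟩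
    · rw [Fin.snoc_castSucc]
      exact fun hx => (h.exists_right hx).imp fun y hy => .inl ⟨(hA x).2 ⟨i, hx⟩, hy⟩
  · intro j y
    refine Fin.lastCases ?_ (fun i => ?_) j
    · rw [Fin.snoc_last]
      intro hy
      obtain ⟨x, hx, rfl⟩ := hcomp _ y hy
      exact ⟨x, .inr ⟨hx, rfl⟩⟩
    · rw [Fin.snoc_castSucc]
      exact fun hy => (h.exists_left hy).imp fun x hx =>
        .inl ⟨(hA x).2 ⟨i, h.symm.reach le_rfl hy hx⟩, hx⟩

theorem IsLocalIso.exists_snoc (hM : M ⊨ ZFA) (h : IsLocalIso (3 * r + 1) a b G) (c : M) :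
    ∃ d, ∃ G' : M → M → Prop,
      IsLocalIso r (Fin.snoc (α := fun _ => M) a c) (Fin.snoc (α := fun _ => M) b d) G' := by
  by_cases hc : ∃ i, Reach DMem (2 * r + 1) (a i) c
  · obtain ⟨i, hi⟩ := hc
    obtain ⟨d, hd⟩ := h.exists_right (hi.mono (by omega))
    exact ⟨d, G, h.snoc_of_reach hi hd⟩
  · obtain ⟨d, -, h'⟩ :=
      (h.mono (by omega : r ≤ 3 * r + 1)).exists_snoc_of_not_reach hM (not_exists.1 hc)
    exact ⟨d, h'⟩

end BackAndForth

/-! ### From unbounded points to components of infinite diameter. -/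

section Diameter

variable {M : Type u} [LSet.Structure M]

theorem reach_of_walk {x y : M} (p : (toSimpleGraph (DGraph M)).Walk x y) :
    Reach (DMem (M := M)) p.length x y := by
  induction p with
  | nil => rfl
  | @cons x z y h p ih =>
    have h1 : Reach (DMem (M := M)) 1 x z := by
      refine ⟨x, rfl, .inr ?_⟩
      rcases h.2 with h | h
      · exact h
      · exact h.symm
    exact (h1.trans ih).mono (Nat.add_comm _ _).le

theorem reachable_of_reach {r : ℕ} {x y : M} (h : Reach (DMem (M := M)) r x y) :
    (toSimpleGraph (DGraph M)).Reachable x y := by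
  induction r generalizing y with
  | zero => obtain rfl := h; exact .rfl
  | succ r ih =>
    obtain ⟨z, hz, hzy⟩ := h
    refine (ih hz).trans ?_
    by_cases e : z = y
    · exact e ▸ .rfl
    · exact SimpleGraph.Adj.reachable ⟨e, .inl (hzy.resolve_left e)⟩

theorem hasComponentOfInfiniteDiameter_of_not_bounded {x : M}
    (hx : ∀ r, ¬Bounded (DMem (M := M)) r x) : HasComponentOfInfiniteDiameter (DGraph M) := by
  let C := (toSimpleGraph (DGraph M)).connectedComponentMk x
  refine ⟨C, SimpleGraph.ediam_eq_top.2 fun k hk => ?_⟩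
  lift k to ℕ using hk.ne
  obtain ⟨y, hy, hy'⟩ : ∃ y, Reach (DMem (M := M)) (k + 1) x y ∧ ¬Reach DMem k x y := by
    simpa [Bounded] using hx k
  have hxC : x ∈ C := SimpleGraph.ConnectedComponent.connectedComponentMk_mem
  have hyC : y ∈ C := SimpleGraph.ConnectedComponent.sound (reachable_of_reach hy).symm
  refine ⟨⟨x, hxC⟩, ⟨y, hyC⟩, not_le.1 fun hle => hy' ?_⟩
  obtain ⟨p, hp⟩ := (C.reachable_toSimpleGraph hxC hyC).exists_walk_length_eq_edist
  have h1 := reach_of_walk (p.map C.toSimpleGraph_hom)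
  rw [SimpleGraph.Walk.length_map] at h1
  refine h1.mono ?_
  rw [← hp] at hle
  exact_mod_cast hle

end Diameter

/-! ### Elementarity of the bounded part. -/

section Elementary

theorem LSD.exists_eq_var {n : ℕ} (t : LSD.Term (Empty ⊕ Fin n)) :
    ∃ i, t = Term.var (Sum.inr i) := by
  rcases t with (i | i) | f
  · exact i.elim
  · exact ⟨i, rfl⟩
  · exact Empty.elim f

variable {M : Type u} [LSet.Structure M] (hM : M ⊨ ZFA)
include hM

/-- Local isomorphisms of large radius preserve a given formula about the SD-graph. -/
theorem exists_radius {n : ℕ} (φ : LSD.BoundedFormula Empty n) :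
    ∃ r, ∀ (a b : Fin n → M) (G : M → M → Prop), IsLocalIso r a b G →
      (φ.Realize (M := SDGraph M) default a ↔ φ.Realize (M := SDGraph M) default b) := by
  induction φ with
  | falsum => exact ⟨0, fun _ _ _ _ => Iff.rfl⟩
  | equal t₁ t₂ =>
    obtain ⟨i, rfl⟩ := LSD.exists_eq_var t₁
    obtain ⟨j, rfl⟩ := LSD.exists_eq_var t₂
    exact ⟨0, fun a b G h => (h.sameType (h.apply i) (h.apply j)).1⟩
  | rel R ts =>
    cases R with
    | S =>
      obtain ⟨i, hi⟩ := LSD.exists_eq_var (ts 0)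
      obtain ⟨j, hj⟩ := LSD.exists_eq_var (ts 1)
      refine ⟨0, fun a b G h => ?_⟩
      have key : ∀ a : Fin _ → M,
          (BoundedFormula.rel (L := LSD) SDRel.S ts).Realize (M := SDGraph M) default a ↔
            SMem (a i) (a j) := fun a => by
        change SMem (M := M) ((ts 0).realize (M := SDGraph M) (Sum.elim default a))
          ((ts 1).realize (M := SDGraph M) (Sum.elim default a)) ↔ _
        rw [hi, hj]
        rfl
      rw [key, key]
      exact (h.sameType (h.apply i) (h.apply j)).2.1
    | D =>
      obtain ⟨i, hi⟩ := LSD.exists_eq_var (ts 0)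
      obtain ⟨j, hj⟩ := LSD.exists_eq_var (ts 1)
      refine ⟨0, fun a b G h => ?_⟩
      have key : ∀ a : Fin _ → M,
          (BoundedFormula.rel (L := LSD) SDRel.D ts).Realize (M := SDGraph M) default a ↔
            DMem (a i) (a j) := fun a => by
        change DMem (M := M) ((ts 0).realize (M := SDGraph M) (Sum.elim default a))
          ((ts 1).realize (M := SDGraph M) (Sum.elim default a)) ↔ _
        rw [hi, hj]
        rfl
      rw [key, key]
      exact (h.sameType (h.apply i) (h.apply j)).2.2
  | imp φ ψ ihφ ihψ =>
    obtain ⟨r, hr⟩ := ihφ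
    obtain ⟨s, hs⟩ := ihψ
    refine ⟨max r s, fun a b G h => ?_⟩
    exact imp_congr (hr a b G (h.mono (le_max_left r s))) (hs a b G (h.mono (le_max_right r s)))
  | all φ ih =>
    obtain ⟨r, hr⟩ := ih
    -- Each quantifier costs one extension step, which shrinks radius `3 * r + 1` to `r`.
    refine ⟨3 * r + 1, fun a b G h => ?_⟩
    constructor
    · intro hφ d
      obtain ⟨c, G', h'⟩ := h.symm.exists_snoc hM d
      exact (hr _ _ _ h'.symm).1 (hφ c)
    · intro hφ c
      obtain ⟨d, G', h'⟩ := h.exists_snoc hM c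
      exact (hr _ _ _ h').2 (hφ d)

omit hM in
variable (M) in
/-- The points of the SD-graph whose component in the D-graph has finite diameter. -/
def boundedPart : LSD.Substructure (SDGraph M) where
  carrier := {x | ∃ r, Bounded (DMem (M := M)) r x}
  fun_mem f := Empty.elim f

/-- Tarski–Vaught: boundedness spreads along `D`-paths, so an unbounded witness is far from all
bounded parameters and can be exchanged for the bounded centre of a copy of its ball, with the
parameters fixed. -/
theorem boundedPart_isElementary : (boundedPart M).IsElementary := by
  refine Substructure.isElementary_of_exists _ fun n φ x c hc => ?_
  by_cases hcN : c ∈ boundedPart M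
  · exact ⟨⟨c, hcN⟩, hc⟩
  obtain ⟨r, hr⟩ := exists_radius hM φ
  let x' : Fin n → M := fun i => (x i).1
  obtain ⟨d, hd, G, hG⟩ := (IsLocalIso.refl r x').exists_snoc_of_not_reach hM (c := c)
    fun i hi => by
      obtain ⟨s, hs⟩ := (x i).2
      exact hcN ⟨_, hs.of_reach (fun _ _ => DMem.symm) hi⟩
  exact ⟨⟨d, r, hd⟩, (hr _ _ G hG).1 hc⟩

end Elementary

/-! ### Boundedness as a first-order property. -/

section Boundedness

/-- The symbol `D` of the language `{S, D}`. -/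
abbrev sdSymD : LSD.Relations 2 := SDRel.D

/-- The interpretation of the symbol `D` in an `{S, D}`-structure. -/
def DRelation {N : Type*} [LSD.Structure N] (x y : N) : Prop := Structure.RelMap sdSymD ![x, y]

/-- The formula which says that `y` can be reached from `x` in at most `r` steps along `D`. -/
def reachFormula : ℕ → {n : ℕ} → Fin n → Fin n → LSD.BoundedFormula Empty n
  | 0, _, x, y => (&x) =' (&y)
  | r + 1, n, x, y => ∃' (reachFormula r x.castSucc (Fin.last n) ⊓
      (((&(Fin.last n)) =' (&y.castSucc)) ⊔
        sdSymD.boundedFormula₂ (&(Fin.last n)) (&y.castSucc)))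

theorem realize_reachFormula {N : Type*} [LSD.Structure N] {r n : ℕ} {x y : Fin n}
    {e : Empty → N} {v : Fin n → N} :
    (reachFormula r x y).Realize e v ↔ Reach DRelation r (v x) (v y) := by
  induction r generalizing n with
  | zero => simp [reachFormula, Reach]
  | succ r ih => simp [reachFormula, Reach, ih, BoundedFormula.realize_rel₂, DRelation]

/-- The formula which says that all points reachable from `x` can be reached in at most `r` steps
along `D`. -/
def boundedFormula (r : ℕ) : LSD.BoundedFormula Empty 1 :=
  ∀' (reachFormula (r + 1) (Fin.castSucc 0) (Fin.last 1) ⟹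
    reachFormula r (Fin.castSucc 0) (Fin.last 1))

theorem realize_boundedFormula {N : Type*} [LSD.Structure N] {r : ℕ} {e : Empty → N}
    {v : Fin 1 → N} : (boundedFormula r).Realize e v ↔ Bounded DRelation r (v 0) := by
  simp only [boundedFormula, BoundedFormula.realize_all, BoundedFormula.realize_imp,
    realize_reachFormula, Fin.snoc_castSucc, Fin.snoc_last, Bounded]

theorem bounded_map_iff {N N' : Type*} [LSD.Structure N] [LSD.Structure N'] (f : N ↪ₑ[LSD] N')
    (r : ℕ) (x : N) : Bounded DRelation r (f x) ↔ Bounded DRelation r x := by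
  have := f.map_boundedFormula (boundedFormula r) default fun _ => x
  rwa [realize_boundedFormula, realize_boundedFormula] at this

theorem Bounded.of_equiv {α β : Type*} {D : α → α → Prop} {D' : β → β → Prop} (f : α ≃ β)
    (h : ∀ x y, D x y ↔ D' (f x) (f y)) {r : ℕ} {x : α} (hx : Bounded D r x) :
    Bounded D' r (f x) := by
  intro y hy
  have h' : ∀ x y, D' x y → D (f.symm x) (f.symm y) := fun x y => by simp [h]
  have := (hx _ (by simpa using hy.map h')).map fun x y => (h x y).1
  simpa using this

end Boundedness

/-! ### The countable structure and the main theorem. -/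

theorem LSD.card_le_aleph0 : LSD.card ≤ Cardinal.aleph0 := by
  have : ∀ n, Countable (LSD.Functions n) := fun n => inferInstanceAs (Countable Empty)
  have : ∀ n, Countable (LSD.Relations n) := fun n =>
    ⟨fun R : SDRel n => match R with
      | SDRel.S => 0
      | SDRel.D => 1, fun R R' h => by cases R <;> cases R' <;> first | rfl | simp at h⟩
  exact Cardinal.mk_le_aleph0_iff.2 (inferInstanceAs (Countable ((Σ _, _) ⊕ (Σ _, _))))

/-- Löwenheim–Skolem is applied to the bounded part; each point inherits its radius because "bounded
with radius `r`" is a single formula. -/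
theorem exists_countable_bounded {M : Type u} [LSet.Structure M] (hM : M ⊨ ZFA) :
    ∃ (N : Type) (_ : LSD.Structure N), Countable N ∧ (N ≅[LSD] SDGraph M) ∧
      ∀ x : N, ∃ r, Bounded DRelation r x := by
  let S : LSD.ElementarySubstructure (SDGraph M) := ⟨boundedPart M, boundedPart_isElementary hM⟩
  have : Infinite (SDGraph M) := infinite_of_models (M := M) hM
  have : Infinite S := S.elementarilyEquivalent.symm.infinite
  obtain ⟨N, ⟨f⟩, hN⟩ := exists_elementaryEmbedding_card_eq_of_le LSD S Cardinal.aleph0.{0} le_rfl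
    (by simpa using LSD.card_le_aleph0) (by simp)
  refine ⟨N, inferInstance, Cardinal.mk_le_aleph0_iff.1 hN.le,
    (S.subtype.comp f).elementarilyEquivalent, fun x => ?_⟩
  obtain ⟨r, hr⟩ := (f x).2
  exact ⟨r, (bounded_map_iff (S.subtype.comp f) r x).1 hr⟩

/-- Forgetting `S`. -/
def dToSD : LD →ᴸ LSD where
  onFunction {_} f := Empty.elim f
  onRelation {_} R := match R with
    | DRel.D => SDRel.D

theorem dToSD_elementarilyEquivalent {M : Type u} [LSet.Structure M] {N : Type*} [LSD.Structure N]
    (h : N ≅[LSD] SDGraph M) :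
    letI := dToSD.reduct N
    N ≅[LD] DGraph M := by
  let := dToSD.reduct N
  let : LSD.Structure (DGraph M) := inferInstanceAs (LSD.Structure (SDGraph M))
  have hE : dToSD.IsExpansionOn (DGraph M) :=
    { map_onFunction := fun f => Empty.elim f
      map_onRelation := fun R _ => by cases R; rfl }
  refine elementarilyEquivalent_iff.2 fun φ => ?_
  rw [← dToSD.realize_onSentence N φ, ← dToSD.realize_onSentence (DGraph M) φ]
  exact elementarilyEquivalent_iff.1 h _

end AntiFoundation

theorem mainTheorem4 (M : Type u) [AntiFoundation.LSet.Structure M]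
    (hM : M ⊨ AntiFoundation.ZFA) :
    (∃ (N : Type) (_ : AntiFoundation.LSD.Structure N),
      Countable N ∧ (N ≅[AntiFoundation.LSD] AntiFoundation.SDGraph M) ∧
      ∀ (K : Type v) [AntiFoundation.LSet.Structure K], K ⊨ AntiFoundation.ZFA →
        IsEmpty (N ≃[AntiFoundation.LSD] AntiFoundation.SDGraph K)) ∧
    (∃ (N' : Type) (_ : AntiFoundation.LD.Structure N'),
      Countable N' ∧ (N' ≅[AntiFoundation.LD] AntiFoundation.DGraph M) ∧
      ∀ (K : Type v) [AntiFoundation.LSet.Structure K], K ⊨ AntiFoundation.ZFA →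
        IsEmpty (N' ≃[AntiFoundation.LD] AntiFoundation.DGraph K)) ∧
    AntiFoundation.HasComponentOfInfiniteDiameter (AntiFoundation.DGraph M) := by
  open AntiFoundation FirstOrder FirstOrder.Language in
  obtain ⟨N, instN, hc, hN, hb⟩ := exists_countable_bounded hM
  -- Only `D` is used, so one argument rules out both kinds of isomorphism.
  have key : ∀ (K : Type v) [LSet.Structure K], K ⊨ ZFA → ∀ f : N ≃ K,
      ¬∀ x y, DRelation x y ↔ DMem (f x) (f y) := by
    intro K _ hK f hf
    obtain ⟨x, hx⟩ := exists_not_bounded hK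
    obtain ⟨r, hr⟩ := hb (f.symm x)
    have := hr.of_equiv f hf
    rw [Equiv.apply_symm_apply] at this
    exact hx r this
  refine ⟨⟨N, instN, hc, hN, fun K _ hK => ⟨fun f => key K hK f.toEquiv fun x y => ?_⟩⟩,
    ⟨N, dToSD.reduct N, hc, dToSD_elementarilyEquivalent hN,
      fun K _ hK => ⟨fun f => ?_⟩⟩, ?_⟩
  · have := f.map_rel sdSymD ![x, y]
    exact this.symm
  · let := dToSD.reduct N
    refine key K hK f.toEquiv fun x y => ?_
    have := f.map_rel dSym ![x, y]
    exact this.symm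
  · obtain ⟨x, hx⟩ := exists_not_bounded hM
    exact hasComponentOfInfiniteDiameter_of_not_bounded hx
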